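/- Let $N,d\in\mathbb{N}_0$ and let $\sigma\in C^1(\mathbb{R})$ satisfy $0<\int_{\mathbb{R}}|\sigma'(x)|\,dx<\infty$ (that is, $\sigma$ is $1$-finite). On a probability space, for each $P>N$ let $A=A^{(P)}$ be a random $P\times N$ matrix, $C=C^{(P)}$ a random $P\times d$ matrix and $b=b^{(P)}$ a random vector in $\mathbb{R}^P$ such that - the $N\times N$ matrix formed by the first $N$ rows of $A$ has $2$-norm less than $1$ almost surely; - the rows $(A_j,C_j,b_j)$ with $N<j\le P$ are independent random variables, all (for all such $j$ and all $P$) with one and the same law, which has full support on $\mathbb{R}^N\times\mathbb{R}^d\times\mathbb{R}$ (every non-empty open set has positive probability). Nothing is assumed on the joint law of the matrices for different values of $P$. Define $F_P:\mathbb{R}^N\times\mathbb{R}^d\to\mathbb{R}^P$ by $F_P(x,z)=\sigma(Ax+Cz+b)$, where $\sigma$ acts entrywise (for $P\le N$ the map $F_P$ plays no role). Let $S\times K\subset\mathbb{R}^N\times\mathbb{R}^d$ be an arbitrary compact set, and let $\mu$ be Lebesgue measure or, more generally, any Borel measure on $\mathbb{R}^N\times\mathbb{R}^d$ that is finite on compact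 sets. Then, almost surely, $\{F_P\}$ is a class of linear universal approximators on $L^2(S\times K,\mathbb{R};\mu)$: almost surely, for every $g\in L^2(S\times K,\mathbb{R};\mu)$ and every $\epsilon>0$ there is $P_0\in\mathbb{N}$ such that for every $P>P_0$ there is $W\in\mathbb{R}^P$ with $W^\top F_P\in L^2(S\times K,\mathbb{R};\mu)$ and $$\lVert W^\top F_P-g\rVert_{L^2(S\times K;\mu)}<\epsilon .$$ -/

import Mathlib

open MeasureTheory ProbabilityTheory
open scoped Matrix

/-- A scalar function `σ` is `ℓ`-finite if it is of class `C^ℓ` and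
`0 < ∫ |σ^(ℓ)(x)| dx < ∞`. -/
def IsEllFinite (ℓ : ℕ) (σ : ℝ → ℝ) : Prop :=
  ContDiff ℝ ℓ σ ∧ Integrable (iteratedDeriv ℓ σ) volume ∧
    0 < ∫ x, |iteratedDeriv ℓ σ x|

/-- The echo state network map `(x, z) ↦ σ(Ax + Cz + b)`, with `σ` acting entrywise. -/
def esnMap {N d P : ℕ} (σ : ℝ → ℝ) (A : Matrix (Fin P) (Fin N) ℝ)
    (C : Matrix (Fin P) (Fin d) ℝ) (b : Fin P → ℝ) :
    (Fin N → ℝ) × (Fin d → ℝ) → Fin P → ℝ :=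
  fun p i => σ ((A *ᵥ p.1 + C *ᵥ p.2 + b) i)

/-- A sequence of maps `F P : X → ℝ^P` is a class of linear universal approximators on a normed
space `V` of (classes of) real functions on `X`; `Rep h f` says that the element `h` of `V` is (the
class of) the function `f`. For all `g ∈ V` and `ε > 0` there is `P₀` such that for all `P > P₀`
some `W ∈ ℝ^P` satisfies `Wᵀ F P ∈ V` and `‖Wᵀ F P - g‖ < ε`. -/
def IsLinearUniversalApproximator {X V : Type*} [NormedAddCommGroup V]
    (Rep : V → (X → ℝ) → Prop) (F : ∀ P : ℕ, X → Fin P → ℝ) : Prop :=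
  ∀ g : V, ∀ ε : ℝ, 0 < ε → ∃ P₀ : ℕ, ∀ P : ℕ, P₀ < P →
    ∃ W : Fin P → ℝ, ∃ h : V, Rep h (fun p => W ⬝ᵥ F P p) ∧ ‖h - g‖ < ε

/-- A sequence of maps `F P : X → ℝ^P` is a class of linear universal approximators on
`L²(S, μ)`: the preceding notion for the Banach space `L²(μ|_S)`, whose elements are functions
up to equality almost everywhere. -/
def IsLinearUniversalApproximatorL2 {X : Type*} [MeasurableSpace X] (μ : Measure X) (S : Set X)
    (F : ∀ P : ℕ, X → Fin P → ℝ) : Prop :=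
  IsLinearUniversalApproximator
    (fun (h : Lp ℝ 2 (μ.restrict S)) (f : X → ℝ) => (h : X → ℝ) =ᵐ[μ.restrict S] f) F

/-! Density and sampling are handled separately. Density: if `h` is orthogonal in L² of the compact
set to every neuron `σ (L x + b)`, differentiating in `b` makes it orthogonal to every `σ' (L x +
b)`. As `σ'` is integrable and nonzero, a Fourier transform in `b` shows that all Fourier
coefficients of `h` vanish, so `h = 0` (`ae_eq_zero_of_integral_neuron_eq_zero`). Sampling: the `P -
N` independent rows all miss a given nonempty open set with probability `q ^ (P - N)`, `q < 1`,
which is summable. Borel–Cantelli and a countable basis give one almost sure event on which the rows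
meet every such set for all large `P` (`ae_forall_isOpen_eventually_exists_mem`). Neurons depend
continuously in L² on their parameters, so sampled neurons can replace those of any approximating
combination. -/

open Filter Topology FourierTransform RealInnerProductSpace
open scoped ENNReal

/-! ### Fourier uniqueness and ridge functions. -/

section Fourier

variable {E : Type*} [NormedAddCommGroup E] [NormedSpace ℝ E] [MeasurableSpace E] [BorelSpace E]
  [SecondCountableTopology E]

/-- An integrable function all of whose Fourier coefficients vanish is zero. -/
theorem ae_eq_zero_of_integral_exp_eq_zero [CompleteSpace E] {μ : Measure E} {h : E → ℝ}
    (hh : Integrable h μ)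
    (h0 : ∀ L : StrongDual ℝ E, ∫ x, (h x : ℂ) * Complex.exp (L x * Complex.I) ∂μ = 0) :
    h =ᵐ[μ] 0 := by
  have hm := hh.aestronglyMeasurable.aemeasurable
  have fin1 := isFiniteMeasure_withDensity_ofReal hh.2
  have fin2 := isFiniteMeasure_withDensity_ofReal hh.neg.2
  have key : ∀ {f : E → ℝ}, Integrable f μ → ∀ L : StrongDual ℝ E,
      Integrable (fun x => ((max (f x) 0 : ℝ) : ℂ) * Complex.exp (L x * Complex.I)) μ ∧
      charFunDual (μ.withDensity fun x => ENNReal.ofReal (f x)) L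
        = ∫ x, ((max (f x) 0 : ℝ) : ℂ) * Complex.exp (L x * Complex.I) ∂μ := by
    intro f hf L
    constructor
    · refine (hf.pos_part.ofReal (𝕜 := ℂ)).mul_bdd (c := 1) ?_ ?_
      · exact Continuous.aestronglyMeasurable (by fun_prop)
      · exact .of_forall fun x => by simp [Complex.norm_exp_ofReal_mul_I]
    · rw [charFunDual_apply, integral_withDensity_eq_integral_toReal_smul₀
        hf.aestronglyMeasurable.aemeasurable.ennreal_ofReal (by simp)]
      refine integral_congr_ae (.of_forall fun x => ?_)
      simp [ENNReal.toReal_ofReal']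
  -- The positive and negative parts of `h` are densities of finite measures with equal
  -- characteristic functions.
  have heq : (μ.withDensity fun x => ENNReal.ofReal (h x))
      = μ.withDensity fun x => ENNReal.ofReal ((-h) x) := by
    refine Measure.ext_of_charFunDual (funext fun L => ?_)
    obtain ⟨i1, e1⟩ := key hh L
    obtain ⟨i2, e2⟩ := key hh.neg L
    rw [e1, e2, ← sub_eq_zero, ← integral_sub i1 i2, ← h0 L]
    refine integral_congr_ae (.of_forall fun x => ?_)
    simp only [← sub_mul, ← Complex.ofReal_sub, Pi.neg_apply]
    congr 2
    rcases le_total (h x) 0 with hx | hx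
    · rw [max_eq_right hx, max_eq_left (by linarith)]; ring
    · rw [max_eq_left hx, max_eq_right (by linarith)]; ring
  have hae := (withDensity_eq_iff hm.ennreal_ofReal hm.neg.ennreal_ofReal
    (by have := measure_ne_top (μ.withDensity fun x => ENNReal.ofReal (h x)) Set.univ
        rwa [withDensity_apply _ MeasurableSet.univ, setLIntegral_univ] at this)).1 heq
  filter_upwards [hae] with x hx
  simp only [Pi.neg_apply] at hx
  rcases le_total (h x) 0 with h1 | h1
  · rw [ENNReal.ofReal_of_nonpos h1, eq_comm, ENNReal.ofReal_eq_zero] at hx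
    simpa using le_antisymm h1 (by linarith)
  · rw [ENNReal.ofReal_of_nonpos (by linarith : -h x ≤ 0), ENNReal.ofReal_eq_zero] at hx
    simpa using le_antisymm hx h1

/-- The Fourier transform of a nonzero continuous integrable function is nonzero at some nonzero
frequency. -/
theorem exists_ne_zero_fourier_ne_zero {f : ℝ → ℂ} (hc : Continuous f) (hf : Integrable f)
    (h0 : f ≠ 0) : ∃ ξ : ℝ, ξ ≠ 0 ∧ 𝓕 f ξ ≠ 0 := by
  by_contra! H
  have hcont : Continuous (𝓕 f) :=
    VectorFourier.fourierIntegral_continuous Real.continuous_fourierChar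
      (by exact continuous_inner) hf
  -- By continuity, vanishing off `0` is vanishing everywhere; Fourier inversion then gives `f = 0`.
  have hz : 𝓕 f = 0 := by
    refine hcont.ext_on (dense_compl_singleton (0 : ℝ)) continuous_zero fun ξ hξ => H ξ hξ
  refine h0 ?_
  rw [← hc.fourierInv_fourier_eq hf (by rw [hz]; exact integrable_zero _ _ _), hz]
  ext x
  simp [Real.fourierInv_eq]

/-- Ridge functions with an integrable continuous nonzero profile separate integrable functions. -/
theorem ae_eq_zero_of_integral_ridge_eq_zero [CompleteSpace E] {μ : Measure E} [SFinite μ]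
    {f : ℝ → ℝ} (hc : Continuous f) (hf : Integrable f) (hf0 : f ≠ 0) {h : E → ℝ}
    (hh : Integrable h μ)
    (H : ∀ (L : StrongDual ℝ E) (b : ℝ), ∫ x, h x * f (L x + b) ∂μ = 0) : h =ᵐ[μ] 0 := by
  obtain ⟨ξ, hξ, hFξ⟩ := exists_ne_zero_fourier_ne_zero (f := fun x => (f x : ℂ))
    (by fun_prop) hf.ofReal (fun h => hf0 (funext fun x => by simpa using congrFun h x))
  refine ae_eq_zero_of_integral_exp_eq_zero hh fun L' => ?_
  -- Translation by `L x` multiplies the transform at `ξ` by `exp (2πi ξ L x)`; since `ξ ≠ 0`,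
  -- rescaling yields any character.
  obtain ⟨L, hL⟩ : ∃ L : StrongDual ℝ E, ∀ x, L' x = 2 * Real.pi * (ξ * L x) :=
    ⟨(2 * Real.pi * ξ)⁻¹ • L', fun x => by
      have : Real.pi ≠ 0 := Real.pi_ne_zero
      simp only [smul_apply, smul_eq_mul]; field_simp⟩
  have hpt : ∀ x, ∫ b, Complex.exp (((-2 * Real.pi * (b * ξ) : ℝ) : ℂ) * Complex.I)
      * ((h x : ℂ) * (f (L x + b) : ℂ))
      = 𝓕 (fun x => (f x : ℂ)) ξ * ((h x : ℂ) * Complex.exp (L' x * Complex.I)) := by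
    intro x
    have hs := integral_add_left_eq_self (μ := volume)
      (fun b : ℝ => Complex.exp (((-2 * Real.pi * (b * ξ) : ℝ) : ℂ) * Complex.I) * (f b : ℂ)) (L x)
    rw [Real.fourier_real_eq_integral_exp_smul]
    simp only [smul_eq_mul]
    have e : (∫ b : ℝ, Complex.exp (((-2 * Real.pi * b * ξ : ℝ) : ℂ) * Complex.I) * (f b : ℂ))
        = ∫ b : ℝ, Complex.exp (((-2 * Real.pi * (b * ξ) : ℝ) : ℂ) * Complex.I) * (f b : ℂ) := by
      simp only [mul_assoc]
    rw [e, ← hs, ← integral_mul_const]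
    refine integral_congr_ae (.of_forall fun b => ?_)
    simp only
    rw [show ∀ a b c d : ℂ, a * b * (c * d) = (a * d) * (c * b) by intros; ring, ← Complex.exp_add]
    congr 2
    rw [hL]; push_cast; ring
  have hint : Integrable (fun p : E × ℝ =>
      Complex.exp (((-2 * Real.pi * (p.2 * ξ) : ℝ) : ℂ) * Complex.I)
      * ((h p.1 : ℂ) * (f (L p.1 + p.2) : ℂ))) (μ.prod volume) := by
    have hreal : Integrable (fun p : E × ℝ => h p.1 * f (L p.1 + p.2)) (μ.prod volume) := by
      have hmeas : AEStronglyMeasurable (fun p : E × ℝ => h p.1 * f (L p.1 + p.2))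
          (μ.prod volume) :=
        hh.aestronglyMeasurable.comp_fst.mul
          (Continuous.aestronglyMeasurable (f := fun p : E × ℝ => f (L p.1 + p.2)) (by fun_prop))
      rw [integrable_prod_iff hmeas]
      refine ⟨.of_forall fun x => (hf.comp_add_left (L x)).const_mul (h x), ?_⟩
      simp only [norm_mul, integral_const_mul]
      simp only [fun x => integral_add_left_eq_self (μ := volume) (fun b : ℝ => ‖f b‖) (L x)]
      exact hh.norm.mul_const _
    have := hreal.ofReal (𝕜 := ℂ)
    simp only [Complex.coe_algebraMap, RCLike.ofReal_mul] at this
    refine Integrable.bdd_mul (c := 1) (by simpa using this)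
      (Continuous.aestronglyMeasurable (by fun_prop)) ?_
    exact .of_forall fun p => by rw [Complex.norm_exp_ofReal_mul_I]
  have hswap := integral_integral_swap (f := fun (x : E) (b : ℝ) =>
    Complex.exp (((-2 * Real.pi * (b * ξ) : ℝ) : ℂ) * Complex.I)
      * ((h x : ℂ) * (f (L x + b) : ℂ))) hint
  simp only [hpt, integral_const_mul] at hswap
  have hz : ∀ b : ℝ, ∫ x, (h x : ℂ) * (f (L x + b) : ℂ) ∂μ = 0 := by
    intro b
    have := congrArg (fun r : ℝ => (r : ℂ)) (H L b)
    rw [← integral_complex_ofReal] at this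
    simpa using this
  simp only [hz, mul_zero, integral_zero] at hswap
  exact (mul_eq_zero.1 hswap).resolve_left hFξ

end Fourier

/-! ### Random sampling and approximation by sampled families. -/

section Approximation

/-- If the points `θ P 0, …, θ P (P - 1)` eventually meet every nonempty open set, then the finite
families `Φ (θ P i)` eventually approximate every vector, provided `Φ` is continuous and its values
span a dense subspace. -/
theorem eventually_exists_sum_smul_near {V Θ : Type*} [NormedAddCommGroup V] [NormedSpace ℝ V]
    [TopologicalSpace Θ] {Φ : Θ → V} (hΦ : Continuous Φ)
    (hspan : (Submodule.span ℝ (Set.range Φ)).topologicalClosure = ⊤) {θ : ∀ P : ℕ, Fin P → Θ}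
    (hit : ∀ U : Set Θ, IsOpen U → U.Nonempty → ∀ᶠ P in atTop, ∃ j, θ P j ∈ U) (g : V) :
    ∀ ε : ℝ, 0 < ε → ∀ᶠ P in atTop, ∃ W : Fin P → ℝ, ‖∑ i, W i • Φ (θ P i) - g‖ < ε := by
  have hs : ∀ f ∈ Submodule.span ℝ (Set.range Φ), ∀ ε : ℝ, 0 < ε →
      ∀ᶠ P in atTop, ∃ W : Fin P → ℝ, ‖∑ i, W i • Φ (θ P i) - f‖ < ε := by
    intro f hf
    induction hf using Submodule.span_induction with
    | mem f hf =>
      obtain ⟨t, rfl⟩ := hf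
      intro ε hε
      filter_upwards [hit (Φ ⁻¹' Metric.ball (Φ t) ε) (Metric.isOpen_ball.preimage hΦ)
        ⟨t, by simpa using hε⟩] with P ⟨j, hj⟩
      refine ⟨Pi.single j 1, ?_⟩
      simpa [Pi.single_apply, dist_eq_norm] using hj
    | zero => exact fun ε hε => .of_forall fun P => ⟨0, by simpa using hε⟩
    | add f₁ f₂ _ _ h₁ h₂ =>
      intro ε hε
      filter_upwards [h₁ _ (half_pos hε), h₂ _ (half_pos hε)] with P ⟨W₁, hW₁⟩ ⟨W₂, hW₂⟩
      refine ⟨W₁ + W₂, ?_⟩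
      simp only [Pi.add_apply, add_smul, Finset.sum_add_distrib, add_sub_add_comm]
      linarith [norm_add_le (∑ i, W₁ i • Φ (θ P i) - f₁) (∑ i, W₂ i • Φ (θ P i) - f₂)]
    | smul c f _ h =>
      intro ε hε
      filter_upwards [h (ε / (|c| + 1)) (by positivity)] with P ⟨W, hW⟩
      refine ⟨c • W, ?_⟩
      simp only [Pi.smul_apply, smul_assoc, ← Finset.smul_sum, ← smul_sub, norm_smul,
        Real.norm_eq_abs]
      rw [lt_div_iff₀ (by positivity)] at hW
      nlinarith [norm_nonneg (∑ i, W i • Φ (θ P i) - f)]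
  intro ε hε
  have hg : g ∈ closure (Submodule.span ℝ (Set.range Φ) : Set V) := by
    rw [← Submodule.topologicalClosure_coe, hspan]; trivial
  obtain ⟨f, hf, hfg⟩ := Metric.mem_closure_iff.1 hg _ (half_pos hε)
  filter_upwards [hs f hf _ (half_pos hε)] with P ⟨W, hW⟩
  refine ⟨W, ?_⟩
  rw [dist_comm, dist_eq_norm] at hfg
  linarith [norm_sub_le_norm_sub_add_norm_sub (∑ i, W i • Φ (θ P i)) f g]

/-- Samples `X P N, …, X P (P - 1)` that are independent with a common law of full support almost
surely meet every nonempty open set for all large `P`, whatever the joint law over `P`. -/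
theorem ae_forall_isOpen_eventually_exists_mem {Ω Θ : Type*} [MeasurableSpace Ω]
    {Pr : Measure Ω} [IsProbabilityMeasure Pr] [TopologicalSpace Θ] [SecondCountableTopology Θ]
    [MeasurableSpace Θ] [OpensMeasurableSpace Θ] {ν : Measure Θ} [ν.IsOpenPosMeasure] {N : ℕ}
    {X : ∀ P : ℕ, Fin P → Ω → Θ} (hX : ∀ P, N < P → ∀ j, Measurable (X P j))
    (hlaw : ∀ P, N < P → ∀ j : Fin P, N ≤ (j : ℕ) → Pr.map (X P j) = ν)
    (hindep : ∀ P, N < P → iIndepFun (fun j : {j : Fin P // N ≤ (j : ℕ)} => X P j.1) Pr) :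
    ∀ᵐ ω ∂Pr, ∀ U : Set Θ, IsOpen U → U.Nonempty → ∀ᶠ P in atTop, ∃ j, X P j ω ∈ U := by
  have hν : IsProbabilityMeasure ν := by
    rw [← hlaw (N + 1) (by omega) (Fin.last N) (by simp)]
    exact Measure.isProbabilityMeasure_map (hX (N + 1) (by omega) _).aemeasurable
  have main : ∀ U : Set Θ, IsOpen U → U.Nonempty →
      ∀ᵐ ω ∂Pr, ∀ᶠ k : ℕ in atTop, ∃ j, X (N + 1 + k) j ω ∈ U := by
    intro U hU hne
    have hq : ν Uᶜ < 1 := by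
      rw [prob_compl_eq_one_sub hU.measurableSet]
      exact ENNReal.sub_lt_self ENNReal.one_ne_top one_ne_zero (hU.measure_pos ν hne).ne'
    have hle : ∀ k : ℕ, Pr {ω | ∀ j, X (N + 1 + k) j ω ∉ U} ≤ ν Uᶜ ^ k := by
      intro k
      have hP : N < N + 1 + k := by omega
      calc Pr {ω | ∀ j, X (N + 1 + k) j ω ∉ U}
          ≤ Pr (⋂ j : {j : Fin (N + 1 + k) // N ≤ (j : ℕ)}, X (N + 1 + k) j.1 ⁻¹' Uᶜ) :=
            measure_mono fun ω hω => Set.mem_iInter.2 fun j => hω j.1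
        _ = ∏ j : {j : Fin (N + 1 + k) // N ≤ (j : ℕ)}, Pr (X (N + 1 + k) j.1 ⁻¹' Uᶜ) :=
            (hindep _ hP).meas_iInter fun j => ⟨Uᶜ, hU.measurableSet.compl, rfl⟩
        _ = ν Uᶜ ^ Fintype.card {j : Fin (N + 1 + k) // N ≤ (j : ℕ)} := by
            rw [← Finset.card_univ, ← Finset.prod_const]
            refine Finset.prod_congr rfl fun j _ => ?_
            rw [← Measure.map_apply (hX _ hP _) hU.measurableSet.compl, hlaw _ hP _ j.2]
        _ ≤ ν Uᶜ ^ k := by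
            refine pow_le_pow_right_of_le_one' hq.le ?_
            refine (Fintype.card_fin k).symm.le.trans (Fintype.card_le_of_injective
              (fun i : Fin k => (⟨⟨N + i, by omega⟩, Nat.le_add_right _ _⟩ :
                {j : Fin (N + 1 + k) // N ≤ (j : ℕ)})) fun i i' h => ?_)
            simpa [Fin.ext_iff] using h
    -- The first Borel–Cantelli lemma needs only summability, hence nothing about the joint law over
    -- `P`.
    have hsum : ∑' k : ℕ, Pr {ω | ∀ j, X (N + 1 + k) j ω ∉ U} ≠ ∞ := by
      refine ((ENNReal.tsum_le_tsum hle).trans_lt ?_).ne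
      rw [ENNReal.tsum_geometric]
      exact ENNReal.inv_lt_top.2 (tsub_pos_of_lt hq)
    filter_upwards [ae_eventually_notMem hsum] with ω hω
    filter_upwards [hω] with k hk
    simpa using hk
  have hB := TopologicalSpace.isBasis_countableBasis Θ
  have hall : ∀ᵐ ω ∂Pr, ∀ U ∈ TopologicalSpace.countableBasis Θ,
      ∀ᶠ k : ℕ in atTop, ∃ j, X (N + 1 + k) j ω ∈ U :=
    (ae_ball_iff (TopologicalSpace.countable_countableBasis Θ)).2 fun U hU =>
      main U (hB.isOpen hU) (TopologicalSpace.nonempty_of_mem_countableBasis hU)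
  filter_upwards [hall] with ω hω U hU ⟨x, hx⟩
  obtain ⟨B, hBm, hxB, hBU⟩ := hB.exists_subset_of_mem_open hx hU
  obtain ⟨k₀, hk₀⟩ := eventually_atTop.1 (hω B hBm)
  refine eventually_atTop.2 ⟨N + 1 + k₀, fun P hP => ?_⟩
  obtain ⟨k, rfl⟩ := Nat.exists_eq_add_of_le (le_trans (Nat.le_add_right _ _) hP)
  obtain ⟨j, hj⟩ := hk₀ k (by omega)
  exact ⟨j, hBU hj⟩

end Approximation

/-! ### Continuous families in L² of a compact set. -/

section Neurons

variable {X Θ : Type*} [TopologicalSpace X] [MeasurableSpace X] [OpensMeasurableSpace X]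
  [T2Space X] [TopologicalSpace Θ] {μ : Measure X} [IsFiniteMeasureOnCompacts μ] {Q : Set X}

theorem Continuous.memLp_two_restrict_of_isCompact
    {f : X → ℝ} (hf : Continuous f) (hQ : IsCompact Q) : MemLp f 2 (μ.restrict Q) := by
  have : IsFiniteMeasure (μ.restrict Q) := ⟨by simpa using hQ.measure_lt_top⟩
  obtain ⟨c, hc⟩ := hQ.exists_bound_of_continuousOn hf.continuousOn
  exact MemLp.of_bound hf.aestronglyMeasurable c
    ((ae_restrict_iff' hQ.measurableSet).2 (.of_forall hc))

/-- A jointly continuous family of functions is continuous as a family in `L²` of a compact set. -/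
theorem continuous_toLp_restrict_of_isCompact
    {F : Θ → X → ℝ} (hF : Continuous (Function.uncurry F)) (hQ : IsCompact Q)
    (hmem : ∀ θ, MemLp (F θ) 2 (μ.restrict Q)) :
    Continuous fun θ : Θ => (hmem θ).toLp (F θ) := by
  have : IsFiniteMeasure (μ.restrict Q) := ⟨by simpa using hQ.measure_lt_top⟩
  rw [continuous_iff_continuousAt]
  intro θ₀
  rw [ContinuousAt, Metric.tendsto_nhds]
  intro ε hε
  -- `c` is the square root of the mass of `Q`, bounding the L² norm by the sup norm; `c + 1` below
  -- covers mass zero.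
  set c : ℝ := (measureUnivNNReal (μ.restrict Q) : ℝ) ^ ((2 : ℝ≥0∞).toReal⁻¹) with hc
  have hc0 : 0 ≤ c := by positivity
  have hev : ∀ᶠ θ in 𝓝 θ₀, ∀ x ∈ Q, |F θ x - F θ₀ x| < ε / (c + 1) := by
    refine hQ.eventually_forall_of_forall_eventually fun y _ => ?_
    have hcont : Continuous fun z : Θ × X => |F z.1 z.2 - F θ₀ z.2| :=
      (hF.sub (hF.comp (continuous_const.prodMk continuous_snd))).abs
    refine (hcont.tendsto (θ₀, y)).eventually_lt_const ?_
    simp only [sub_self, abs_zero]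
    positivity
  filter_upwards [hev] with θ hθ
  rw [dist_eq_norm, ← MemLp.toLp_sub]
  have hb := Lp.norm_le_of_ae_bound (f := ((hmem θ).sub (hmem θ₀)).toLp (F θ - F θ₀))
    (C := ε / (c + 1)) (by positivity) (by
      filter_upwards [((hmem θ).sub (hmem θ₀)).coeFn_toLp,
        ae_restrict_mem hQ.measurableSet] with x hx hxQ
      rw [hx]
      exact (hθ x hxQ).le)
  refine hb.trans_lt ?_
  rw [← hc, mul_div_assoc', div_lt_iff₀ (by positivity)]
  nlinarith

end Neurons

/-! ### Density of the span of neurons. -/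

section Density

/-- Neurons `x ↦ σ (L x + b)` with `σ` of class `C¹` whose derivative is integrable and not
identically zero separate the integrable functions on a compact set. -/
theorem ae_eq_zero_of_integral_neuron_eq_zero {E : Type*} [NormedAddCommGroup E] [NormedSpace ℝ E]
    [MeasurableSpace E] [BorelSpace E] [SecondCountableTopology E] [CompleteSpace E]
    {μ : Measure E} [SFinite μ] {Q : Set E} (hQ : IsCompact Q) (hμQ : ∀ᵐ x ∂μ, x ∈ Q)
    {σ : ℝ → ℝ} (hσ : ContDiff ℝ 1 σ) (hint : Integrable (deriv σ)) (hne : deriv σ ≠ 0)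
    {h : E → ℝ} (hh : Integrable h μ)
    (H : ∀ (L : StrongDual ℝ E) (b : ℝ), ∫ x, h x * σ (L x + b) ∂μ = 0) : h =ᵐ[μ] 0 := by
  have hσ' : Continuous (deriv σ) := hσ.continuous_deriv_one
  have hσc : Continuous σ := hσ.continuous
  refine ae_eq_zero_of_integral_ridge_eq_zero hσ' hint hne hh fun L b => ?_
  obtain ⟨c₀, hc₀⟩ := hQ.exists_bound_of_continuousOn
    (f := fun x => σ (L x + b)) (by fun_prop)
  obtain ⟨c₁, hc₁⟩ := (hQ.prod (isCompact_closedBall b 1)).exists_bound_of_continuousOn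
    (f := fun p : E × ℝ => deriv σ (L p.1 + p.2)) (by fun_prop)
  -- `σ` need not be integrable, so the ridge lemma is applied to `σ'`; compactness of `Q` supplies
  -- the dominating bound for biases within `1` of `b`.
  have hd := (hasDerivAt_integral_of_dominated_loc_of_deriv_le (μ := μ)
    (F := fun (t : ℝ) x => h x * σ (L x + t)) (F' := fun (t : ℝ) x => h x * deriv σ (L x + t))
    (x₀ := b) (bound := fun x => |h x| * c₁) (Metric.closedBall_mem_nhds b one_pos)
    (.of_forall fun t => hh.aestronglyMeasurable.mul
      (Continuous.aestronglyMeasurable (f := fun x => σ (L x + t)) (by fun_prop)))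
    (hh.mul_bdd (c := c₀) (Continuous.aestronglyMeasurable (by fun_prop))
      (hμQ.mono hc₀))
    (hh.aestronglyMeasurable.mul
      (Continuous.aestronglyMeasurable (f := fun x => deriv σ (L x + b)) (by fun_prop)))
    (hμQ.mono fun x hx t ht => by
      rw [norm_mul]
      exact mul_le_mul_of_nonneg_left (hc₁ (x, t) ⟨hx, ht⟩) (norm_nonneg _))
    (hh.abs.mul_const _)
    (.of_forall fun x t _ =>
      (((hσ.differentiable one_ne_zero _).hasDerivAt).comp_const_add (L x) t).const_mul (h x))).2
  simp only [H] at hd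
  exact hd.unique (hasDerivAt_const b 0)

theorem exists_dotProduct_eq_strongDual {N d : ℕ}
    (L : StrongDual ℝ ((Fin N → ℝ) × (Fin d → ℝ))) :
    ∃ (a : Fin N → ℝ) (c : Fin d → ℝ), ∀ p, L p = a ⬝ᵥ p.1 + c ⬝ᵥ p.2 := by
  refine ⟨fun i => L (fun j => if i = j then 1 else 0, 0),
    fun i => L (0, fun j => if i = j then 1 else 0), fun p => ?_⟩
  have e1 := LinearMap.pi_apply_eq_sum_univ (L.toLinearMap ∘ₗ LinearMap.inl ℝ _ _) p.1
  have e2 := LinearMap.pi_apply_eq_sum_univ (L.toLinearMap ∘ₗ LinearMap.inr ℝ _ _) p.2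
  simp only [LinearMap.comp_apply, LinearMap.inl_apply, LinearMap.inr_apply,
    ContinuousLinearMap.coe_coe, smul_eq_mul] at e1 e2
  calc L p = L (p.1, 0) + L (0, p.2) := by rw [← map_add]; simp
    _ = _ := by simp only [e1, e2, dotProduct, mul_comm]

/-- The neuron `(x, z) ↦ σ (a ⬝ x + c ⬝ z + b)` with parameters `(a, c, b)`. -/
def neuron {N d : ℕ} (σ : ℝ → ℝ) (θ : (Fin N → ℝ) × (Fin d → ℝ) × ℝ)
    (p : (Fin N → ℝ) × (Fin d → ℝ)) : ℝ :=
  σ (θ.1 ⬝ᵥ p.1 + θ.2.1 ⬝ᵥ p.2 + θ.2.2)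

theorem continuous_uncurry_neuron {N d : ℕ} {σ : ℝ → ℝ} (hσ : Continuous σ) :
    Continuous (Function.uncurry (neuron (N := N) (d := d) σ)) := by
  unfold neuron Function.uncurry dotProduct
  fun_prop

/-- In a Hilbert space it suffices that the orthogonal complement be trivial; its elements are
integrable because the restricted measure is finite. -/
theorem topologicalClosure_span_neuron_eq_top {N d : ℕ} {σ : ℝ → ℝ} (hσ : IsEllFinite 1 σ)
    {Q : Set ((Fin N → ℝ) × (Fin d → ℝ))} (hQ : IsCompact Q)
    {μ : Measure ((Fin N → ℝ) × (Fin d → ℝ))} [IsFiniteMeasureOnCompacts μ]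
    (hmem : ∀ θ, MemLp (neuron σ θ) 2 (μ.restrict Q)) :
    (Submodule.span ℝ (Set.range fun θ => (hmem θ).toLp (neuron σ θ))).topologicalClosure = ⊤ := by
  obtain ⟨hσ1, hint, hpos⟩ := hσ
  rw [iteratedDeriv_one] at hint hpos
  have hne : deriv σ ≠ 0 := by
    intro h0
    simp [h0] at hpos
  have : IsFiniteMeasure (μ.restrict Q) := ⟨by simpa using hQ.measure_lt_top⟩
  rw [Submodule.topologicalClosure_eq_top_iff, Submodule.eq_bot_iff]
  intro h hh
  rw [Lp.eq_zero_iff_ae_eq_zero]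
  refine ae_eq_zero_of_integral_neuron_eq_zero hQ (ae_restrict_mem hQ.measurableSet)
    (by exact_mod_cast hσ1) hint hne ((Lp.memLp h).integrable one_le_two) fun L b => ?_
  obtain ⟨a, c, hL⟩ := exists_dotProduct_eq_strongDual L
  rw [← (Submodule.mem_orthogonal _ h).1 hh _ (Submodule.subset_span ⟨(a, c, b), rfl⟩),
    L2.inner_def]
  refine integral_congr_ae ?_
  filter_upwards [(hmem (a, c, b)).coeFn_toLp] with x hx
  simp [hx, neuron, hL]

end Density

theorem coeFn_sum_smul_toLp {X ι : Type*} [MeasurableSpace X] {μ : Measure X} {f : ι → X → ℝ}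
    (hf : ∀ i, MemLp (f i) 2 μ) (W : ι → ℝ) (s : Finset ι) :
    (∑ i ∈ s, W i • (hf i).toLp (f i) : Lp ℝ 2 μ) =ᵐ[μ] fun x => ∑ i ∈ s, W i * f i x := by
  classical
  induction s using Finset.induction_on with
  | empty => simpa only [Finset.sum_empty] using! Lp.coeFn_zero ℝ 2 μ
  | insert i s hi ih =>
    rw [Finset.sum_insert hi]
    filter_upwards [Lp.coeFn_add (W i • (hf i).toLp (f i)) (∑ i ∈ s, W i • (hf i).toLp (f i)),
      Lp.coeFn_smul (W i) ((hf i).toLp (f i)), (hf i).coeFn_toLp, ih] with x h₁ h₂ h₃ h₄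
    rw [h₁, Pi.add_apply, h₂, h₄, Finset.sum_insert hi, Pi.smul_apply, h₃, smul_eq_mul]

theorem mainTheorem6 {N d : ℕ} (σ : ℝ → ℝ) (hσ : IsEllFinite 1 σ)
    {Ω : Type*} [MeasurableSpace Ω] (Pr : Measure Ω) [IsProbabilityMeasure Pr]
    -- for each `P`, the random `P × N` matrix `A`, the random `P × d` matrix `C`, the random
    -- vector `b`; only `P > N` matters
    (A : ∀ P : ℕ, Ω → Matrix (Fin P) (Fin N) ℝ)
    (C : ∀ P : ℕ, Ω → Matrix (Fin P) (Fin d) ℝ)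
    (b : ∀ P : ℕ, Ω → Fin P → ℝ)
    (hA : ∀ P, N < P → ∀ i j, Measurable (fun ω => A P ω i j))
    (hC : ∀ P, N < P → ∀ i j, Measurable (fun ω => C P ω i j))
    (hb : ∀ P, N < P → ∀ i, Measurable (fun ω => b P ω i))
    -- the first `N` rows of `A` form a matrix of 2-norm less than one, almost surely
    (hnorm : ∀ P, ∀ hP : N < P, ∀ᵐ ω ∂Pr,
      ‖Matrix.toEuclideanCLM (𝕜 := ℝ) ((A P ω).submatrix (Fin.castLE hP.le) id)‖ < 1)
    -- the later rows `(A_j, C_j, b_j)` are independent, with a common law of full support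
    (ν : Measure ((Fin N → ℝ) × (Fin d → ℝ) × ℝ)) [ν.IsOpenPosMeasure]
    (hlaw : ∀ P, N < P → ∀ j : Fin P, N ≤ (j : ℕ) →
      Pr.map (fun ω => ((A P ω).row j, (C P ω).row j, b P ω j)) = ν)
    (hindep : ∀ P, N < P → iIndepFun
      (fun (j : {j : Fin P // N ≤ (j : ℕ)}) ω =>
        ((A P ω).row j.1, (C P ω).row j.1, b P ω j.1)) Pr)
    -- a compact set `S × K` with a Borel measure, finite on compact sets (such as Lebesgue measure)
    (S : Set (Fin N → ℝ)) (K : Set (Fin d → ℝ)) (hSK : IsCompact (S ×ˢ K))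
    (μ : Measure ((Fin N → ℝ) × (Fin d → ℝ))) [IsFiniteMeasureOnCompacts μ] :
    ∀ᵐ ω ∂Pr, IsLinearUniversalApproximatorL2 μ (S ×ˢ K)
      (fun P => esnMap σ (A P ω) (C P ω) (b P ω)) := by
  have hc := continuous_uncurry_neuron (N := N) (d := d) hσ.1.continuous
  have hmem : ∀ θ, MemLp (neuron σ θ) 2 (μ.restrict (S ×ˢ K)) := fun θ =>
    (hc.comp (Continuous.prodMk_right θ)).memLp_two_restrict_of_isCompact hSK
  have hhit := ae_forall_isOpen_eventually_exists_mem (Pr := Pr) (ν := ν) (N := N)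
    (X := fun P j ω => ((A P ω).row j, (C P ω).row j, b P ω j))
    (fun P hP j => (measurable_pi_lambda _ fun i => hA P hP j i).prodMk
      ((measurable_pi_lambda _ fun i => hC P hP j i).prodMk (hb P hP j))) hlaw hindep
  filter_upwards [hhit] with ω hω g ε hε
  obtain ⟨P₀, hP₀⟩ := eventually_atTop.1 (eventually_exists_sum_smul_near
    (continuous_toLp_restrict_of_isCompact hc hSK hmem)
    (topologicalClosure_span_neuron_eq_top hσ hSK hmem) hω g ε hε)
  refine ⟨P₀, fun P hP => ?_⟩
  obtain ⟨W, hW⟩ := hP₀ P hP.le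
  refine ⟨W, _, ?_, hW⟩
  filter_upwards [coeFn_sum_smul_toLp
    (fun i => hmem ((A P ω).row i, (C P ω).row i, b P ω i)) W Finset.univ] with p hp
  rw [hp]
  rfl
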